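/- Let $H$ be a real or complex Hilbert space and let $T$ be a linear operator in $H$ whose domain $\operatorname{dom}T$ is a dense linear subspace of $H$ and which is positive symmetric, i.e. $\langle Tf,g\rangle=\langle f,Tg\rangle$ and $\langle Tf,f\rangle\ge 0$ for all $f,g\in\operatorname{dom}T$. Let $\mathcal E_T$ be the energy space of $T$, that is, the Hilbert space completion of $\operatorname{ran}T$ with respect to the inner product $\langle Tf,Th\rangle_T:=\langle Tf,h\rangle$ $(f,h\in\operatorname{dom}T)$, and let $Q_T:\operatorname{dom}T\subseteq H\to\mathcal E_T$ be the operator $Q_Tf:=Tf$. For positive self-adjoint operators $S_1,S_2$ in $H$ write $S_1\preceq S_2$ if $(I+S_2)^{-1}\le (I+S_1)^{-1}$, and denote by $A^{1/2}$ the positive self-adjoint square root of a positive self-adjoint operator $A$. Then $Q_T^*$ is densely defined (so that $Q_T^{**}$ makes sense), and $T_F:=Q_T^*Q_T^{**}$ is the largest positive self-adjoint extension of $T$: it is a positive self-adjoint operator extending $T$, and $S\preceq T_F$ for every positive self-adjoint extension $S$ of $T$. Moreover, $T_F$ has a positive self-adjoint square root $T_F^{1/2}$. A vector $g\in H$ belongs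 to $\operatorname{dom}T_F^{1/2}$ if and only if there is a sequence $(g_n)$ in $\operatorname{dom}T$ such that $$g_n\to g\quad\text{and}\quad \langle T(g_n-g_m),g_n-g_m\rangle\to 0\quad (n,m\to\infty),$$ and for every such sequence $$\|T_F^{1/2}g\|^2=\lim_{n\to\infty}\langle Tg_n,g_n\rangle .$$ -/

import Mathlib

open Filter Topology

noncomputable section

namespace FriedrichsExt

variable {𝕜 : Type*} [RCLike 𝕜]
variable {H : Type*} [NormedAddCommGroup H] [InnerProductSpace 𝕜 H]

/-- A (not necessarily densely defined) linear operator `T` in `H` is *positive symmetric* if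
`⟪T f, g⟫ = ⟪f, T g⟫` for all `f, g ∈ dom T` and `⟪T f, f⟫ ≥ 0` for all `f ∈ dom T`
(the number `⟪T f, f⟫` is real by symmetry). -/
structure IsPositiveSymmetric (T : H →ₗ.[𝕜] H) : Prop where
  symm : ∀ f g : T.domain, inner 𝕜 (T f) (g : H) = inner 𝕜 (f : H) (T g)
  nonneg : ∀ f : T.domain, 0 ≤ RCLike.re (inner 𝕜 (T f) (f : H))

/-- The composition `B A` of two partially defined operators, on its natural domain
`{x ∈ dom A | A x ∈ dom B}`. -/
def pcomp {E F G : Type*} [AddCommGroup E] [Module 𝕜 E] [AddCommGroup F] [Module 𝕜 F]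
    [AddCommGroup G] [Module 𝕜 G] (B : F →ₗ.[𝕜] G) (A : E →ₗ.[𝕜] F) : E →ₗ.[𝕜] G where
  domain :=
    { carrier := {x | ∃ h : x ∈ A.domain, A ⟨x, h⟩ ∈ B.domain}
      zero_mem' := ⟨A.domain.zero_mem, by
        have h : A ⟨0, A.domain.zero_mem⟩ = 0 := A.map_zero
        rw [h]
        exact B.domain.zero_mem⟩
      add_mem' := by
        rintro x y ⟨hx, hx'⟩ ⟨hy, hy'⟩
        refine ⟨A.domain.add_mem hx hy, ?_⟩
        have h : A ⟨x + y, A.domain.add_mem hx hy⟩ = A ⟨x, hx⟩ + A ⟨y, hy⟩ :=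
          A.map_add ⟨x, hx⟩ ⟨y, hy⟩
        rw [h]
        exact B.domain.add_mem hx' hy'
      smul_mem' := by
        rintro c x ⟨hx, hx'⟩
        refine ⟨A.domain.smul_mem c hx, ?_⟩
        have h : A ⟨c • x, A.domain.smul_mem c hx⟩ = c • A ⟨x, hx⟩ := A.map_smul c ⟨x, hx⟩
        rw [h]
        exact B.domain.smul_mem c hx' }
  toFun :=
    { toFun := fun x => B ⟨A ⟨x.1, x.2.1⟩, x.2.2⟩
      map_add' := by
        rintro ⟨x, hx, hx'⟩ ⟨y, hy, hy'⟩
        rw [← B.map_add]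
        congr 1
        exact Subtype.ext (A.map_add ⟨x, hx⟩ ⟨y, hy⟩)
      map_smul' := by
        rintro c ⟨x, hx, hx'⟩
        rw [RingHom.id_apply, ← B.map_smul]
        congr 1
        exact Subtype.ext (A.map_smul c ⟨x, hx⟩) }

/-- `R` is a positive self-adjoint square root of `A`: it is positive, self-adjoint and
`R R = A` (equality of operators, domains included). -/
structure IsPositiveSqrt (R A : H →ₗ.[𝕜] H) [CompleteSpace H] : Prop where
  positive : IsPositiveSymmetric R
  selfAdjoint : IsSelfAdjoint R
  comp_self : pcomp R R = A

/-- The operator `(I + S)⁻¹`, defined on `ran (I + S)`. -/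
def invOneAdd (S : H →ₗ.[𝕜] H) : H →ₗ.[𝕜] H :=
  ((LinearMap.id : H →ₗ[𝕜] H) +ᵥ S).inverse

/-- The form order `S₁ ⪯ S₂` of positive self-adjoint operators: `(I + S₂)⁻¹ ≤ (I + S₁)⁻¹`, where
both inverses are everywhere defined and are compared through their quadratic forms. -/
def FormLE (S₁ S₂ : H →ₗ.[𝕜] H) : Prop :=
  ∀ x : H, ∃ (h₁ : x ∈ (invOneAdd S₁).domain) (h₂ : x ∈ (invOneAdd S₂).domain),
    RCLike.re (inner 𝕜 (invOneAdd S₂ ⟨x, h₂⟩) x) ≤ RCLike.re (inner 𝕜 (invOneAdd S₁ ⟨x, h₁⟩) x)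

/-! ### The energy space -/

/-- The range of `T`, as a type which is going to carry the energy inner product
`⟪T f, T h⟫ = ⟪T f, h⟫`. -/
def EnergyRange (T : H →ₗ.[𝕜] H) (_hT : IsPositiveSymmetric T) : Type _ :=
  LinearMap.range T.toFun

section Energy

variable (T : H →ₗ.[𝕜] H) (hT : IsPositiveSymmetric T)

instance : AddCommGroup (EnergyRange T hT) :=
  inferInstanceAs (AddCommGroup (LinearMap.range T.toFun))

instance : Module 𝕜 (EnergyRange T hT) :=
  inferInstanceAs (Module 𝕜 (LinearMap.range T.toFun))

/-- `T` as a linear map from `dom T` onto its range. -/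
def toEnergyRange : T.domain →ₗ[𝕜] EnergyRange T hT :=
  T.toFun.rangeRestrict

/-- A vector `h ∈ dom T` with `T h = x`. -/
def energyPreimage (x : EnergyRange T hT) : T.domain :=
  x.2.choose

theorem toEnergyRange_preimage (x : EnergyRange T hT) :
    toEnergyRange T hT (energyPreimage T hT x) = x :=
  Subtype.ext x.2.choose_spec

variable {T hT} in
theorem apply_eq_of_toEnergyRange_eq {f g : T.domain}
    (h : toEnergyRange T hT f = toEnergyRange T hT g) : T f = T g :=
  congrArg (fun x : EnergyRange T hT => (show LinearMap.range T.toFun from x).1) h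

/-- The energy inner product on `ran T`; by `energy_inner` below it is given by
`⟪T f, T h⟫ = ⟪T f, h⟫`. -/
instance energyCore : PreInnerProductSpace.Core 𝕜 (EnergyRange T hT) where
  inner x y := inner 𝕜 (T (energyPreimage T hT x)) (energyPreimage T hT y : H)
  conj_inner_symm x y := by
    rw [inner_conj_symm, hT.symm]
  re_inner_nonneg x := hT.nonneg _
  add_left x y z := by
    have h : T (energyPreimage T hT (x + y)) =
        T (energyPreimage T hT x) + T (energyPreimage T hT y) := by
      rw [← T.map_add]
      apply apply_eq_of_toEnergyRange_eq (hT := hT)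
      rw [map_add, toEnergyRange_preimage, toEnergyRange_preimage, toEnergyRange_preimage]
    rw [h, inner_add_left]
  smul_left x y r := by
    have h : T (energyPreimage T hT (r • x)) = r • T (energyPreimage T hT x) := by
      rw [← T.map_smul]
      apply apply_eq_of_toEnergyRange_eq (hT := hT)
      rw [map_smul, toEnergyRange_preimage, toEnergyRange_preimage]
    rw [h, inner_smul_left]

/-- The (semi)norm of the energy inner product. It is a norm when `T` is densely defined. -/
instance : SeminormedAddCommGroup (EnergyRange T hT) :=
  InnerProductSpace.Core.toSeminormedAddCommGroup (𝕜 := 𝕜)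

instance : InnerProductSpace 𝕜 (EnergyRange T hT) :=
  InnerProductSpace.ofCore (energyCore T hT)

theorem energy_inner (f h : T.domain) :
    inner 𝕜 (toEnergyRange T hT f) (toEnergyRange T hT h) = inner 𝕜 (T f) (h : H) := by
  have hf : T (energyPreimage T hT (toEnergyRange T hT f)) = T f :=
    apply_eq_of_toEnergyRange_eq (toEnergyRange_preimage T hT _)
  have hh : T (energyPreimage T hT (toEnergyRange T hT h)) = T h :=
    apply_eq_of_toEnergyRange_eq (toEnergyRange_preimage T hT _)
  change inner 𝕜 (T (energyPreimage T hT (toEnergyRange T hT f)))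
    (energyPreimage T hT (toEnergyRange T hT h) : H) = _
  rw [hf, hT.symm, hh, ← hT.symm]

/-- The energy space `𝓔_T`: the Hilbert space completion of `ran T` with respect to the energy
inner product `⟪T f, T h⟫ = ⟪T f, h⟫`. -/
abbrev EnergySpace : Type _ := UniformSpace.Completion (EnergyRange T hT)

/-- The operator `Q_T : H → 𝓔_T` with domain `dom T` and `Q_T f = T f ∈ ran T ⊆ 𝓔_T`. -/
def energyOp : H →ₗ.[𝕜] EnergySpace T hT where
  domain := T.domain
  toFun := (UniformSpace.Completion.toComplₗᵢ (𝕜 := 𝕜) (E := EnergyRange T hT)).toLinearMap ∘ₗ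
    toEnergyRange T hT

/-- The operator `T_F = Q_T^* Q_T^{**}`. -/
def friedrichs [CompleteSpace H] : H →ₗ.[𝕜] H :=
  pcomp (energyOp T hT).adjoint (energyOp T hT).adjoint.adjoint

end Energy

/-- The sequence `u` in `dom T` converges to `g` in `H` and is Cauchy in the energy of `T`, that is,
`⟪T (u n - u m), u n - u m⟫ → 0` as `n, m → ∞`. -/
def EnergyConverges (T : H →ₗ.[𝕜] H) (u : ℕ → T.domain) (g : H) : Prop :=
  Tendsto (fun n => (u n : H)) atTop (𝓝 g) ∧
  Tendsto (fun p : ℕ × ℕ =>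
    inner 𝕜 (T (u p.1 - u p.2)) ((u p.1 - u p.2 : T.domain) : H)) atTop (𝓝 0)

end FriedrichsExt

end

/-! Put `A = Q_T**`, the closure of `Q_T`. It is defined because `Q_T*` fixes every vector of `ran
T`, which is dense in the energy space. As `A* = Q_T*`, the operator `T_F` equals `A* A`, so
everything reduces to von Neumann's theory of `A* A` for a closed densely defined `A`. Projecting
`(x, 0)` onto the graph of `A` solves `(I + A* A) y = x`; with positivity this gives
self-adjointness (`isSelfAdjoint_of_surjective`). Maximality is variational: `⟪(I + S)⁻¹ x, x⟫`
bounds `2 re ⟪v, x⟫ - ‖v‖² - ⟪S v, v⟫` on `dom T`, and this bound passes to the closure `A`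
(`formLE_adjoint_comp_self`). A square root is built from bounded square roots of `(I + T_F)⁻¹` and
its complement (`exists_isPositiveSqrt`). Any such root `R` satisfies `R* R = A* A`, hence `dom R =
dom A` and `‖R g‖ = ‖A g‖` (`exists_mem_graph_norm_eq`). Membership in the graph of the closure `A`
is exactly the sequence condition. -/

namespace FriedrichsExt

open LinearPMap hiding map_add map_zero map_neg map_sub map_smul

/-! ### Graphs, adjoints and von Neumann's theory of `A* A`. -/

section Graph

variable {𝕜 : Type*} [RCLike 𝕜]
variable {E F G : Type*} [NormedAddCommGroup E] [InnerProductSpace 𝕜 E]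
  [NormedAddCommGroup F] [InnerProductSpace 𝕜 F] [NormedAddCommGroup G] [InnerProductSpace 𝕜 G]

theorem mem_graph_pcomp {A : E →ₗ.[𝕜] F} {B : F →ₗ.[𝕜] G} {x : E} {z : G} :
    (x, z) ∈ (pcomp B A).graph ↔ ∃ y, (x, y) ∈ A.graph ∧ (y, z) ∈ B.graph := by
  constructor
  · intro h
    obtain ⟨⟨w, h₁, h₂⟩, h, rfl⟩ := (mem_graph_iff _).1 h
    obtain rfl : w = x := h
    exact ⟨A ⟨w, h₁⟩, A.mem_graph ⟨w, h₁⟩, B.mem_graph ⟨_, h₂⟩⟩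
  · rintro ⟨y, h₁, h₂⟩
    obtain ⟨⟨w, hw⟩, h, rfl⟩ := (mem_graph_iff _).1 h₁
    obtain rfl : w = x := h
    obtain ⟨⟨v, hv⟩, h, rfl⟩ := (mem_graph_iff _).1 h₂
    obtain rfl : v = A ⟨w, hw⟩ := h
    exact (pcomp B A).mem_graph ⟨w, hw, hv⟩

theorem mem_graph_adjoint [CompleteSpace E] {A : E →ₗ.[𝕜] F} (hA : Dense (A.domain : Set E))
    {y : F} {z : E} :
    (y, z) ∈ A.adjoint.graph ↔ ∀ a b, (a, b) ∈ A.graph → inner 𝕜 b y = inner 𝕜 a z := by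
  rw [adjoint_graph_eq_graph_adjoint hA, Submodule.mem_adjoint_iff]
  simp only [sub_eq_zero]

/-- The orthogonal projection onto a closed subspace of `E × F`, with the Hilbert structure. -/
theorem exists_mem_inner_sub_eq_zero [CompleteSpace E] [CompleteSpace F]
    {K : Submodule 𝕜 (E × F)} (hK : IsClosed (K : Set (E × F))) (x : E) (y : F) :
    ∃ x' y', (x', y') ∈ K ∧
      ∀ a b, (a, b) ∈ K → inner 𝕜 a (x - x') + inner 𝕜 b (y - y') = 0 := by
  let e := WithLp.linearEquiv 2 𝕜 (E × F)
  let K' : Submodule 𝕜 (WithLp 2 (E × F)) := K.comap e.toLinearMap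
  have hK' : IsClosed (K' : Set (WithLp 2 (E × F))) :=
    hK.preimage (WithLp.prod_continuous_ofLp 2 E F)
  have : CompleteSpace K' := hK'.completeSpace_coe
  refine ⟨(K'.starProjection (WithLp.toLp 2 (x, y))).fst,
    (K'.starProjection (WithLp.toLp 2 (x, y))).snd, K'.starProjection_apply_mem _,
    fun a b hab => ?_⟩
  have h := K'.sub_starProjection_mem_orthogonal (WithLp.toLp 2 (x, y)) (WithLp.toLp 2 (a, b)) hab
  simpa [WithLp.prod_inner_apply] using h

/-- The bipolar identity `K⊥⊥ = closure K`: the hypothesis is applied to the residual of the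
projection onto the closure, which is then orthogonal to itself. -/
theorem mem_topologicalClosure_of_forall_inner [CompleteSpace E] [CompleteSpace F]
    {K : Submodule 𝕜 (E × F)} {x : E} {y : F}
    (h : ∀ u v, (∀ a b, (a, b) ∈ K → inner 𝕜 a u + inner 𝕜 b v = 0) →
      inner 𝕜 x u + inner 𝕜 y v = 0) : (x, y) ∈ K.topologicalClosure := by
  obtain ⟨x', y', hK, ho⟩ := exists_mem_inner_sub_eq_zero K.isClosed_topologicalClosure x y
  have h₁ := h _ _ fun a b hab => ho a b (K.le_topologicalClosure hab)
  have h₂ := ho _ _ hK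
  have h₃ : inner 𝕜 (x - x') (x - x') + inner 𝕜 (y - y') (y - y') = 0 := by
    rw [inner_sub_left, inner_sub_left]
    linear_combination h₁ - h₂
  have h₄ : ‖x - x'‖ ^ 2 + ‖y - y'‖ ^ 2 = 0 := by
    rw [inner_self_eq_norm_sq_to_K, inner_self_eq_norm_sq_to_K] at h₃
    exact_mod_cast h₃
  have hx : x = x' := by
    rw [← sub_eq_zero, ← norm_eq_zero]
    nlinarith [sq_nonneg ‖x - x'‖, sq_nonneg ‖y - y'‖]
  have hy : y = y' := by
    rw [← sub_eq_zero, ← norm_eq_zero]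
    nlinarith [sq_nonneg ‖x - x'‖, sq_nonneg ‖y - y'‖]
  rwa [hx, hy]

/-- A pair `(u, v)` is orthogonal to the graph of `A` iff `(v, -u)` lies in the graph of `A*`; doing
this twice gives the double orthogonal complement of the graph. -/
theorem graph_adjoint_adjoint [CompleteSpace E] [CompleteSpace F] {A : E →ₗ.[𝕜] F}
    (hA : Dense (A.domain : Set E)) (hA' : Dense (A.adjoint.domain : Set F)) :
    A.adjoint.adjoint.graph = A.graph.topologicalClosure := by
  apply le_antisymm
  · rintro ⟨x, y⟩ hxy
    apply mem_topologicalClosure_of_forall_inner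
    intro u v huv
    have h : (v, -u) ∈ A.adjoint.graph := by
      rw [mem_graph_adjoint hA]
      intro a b hab
      rw [inner_neg_right]
      linear_combination huv a b hab
    have h' := (mem_graph_adjoint hA').1 hxy _ _ h
    rw [← inner_conj_symm x, ← inner_conj_symm y, ← h', ← map_add, inner_neg_left]
    simp
  · apply Submodule.topologicalClosure_minimal _ _ (adjoint_isClosed hA')
    rintro ⟨x, y⟩ hxy
    rw [mem_graph_adjoint hA']
    intro a b hab
    rw [← inner_conj_symm, ← (mem_graph_adjoint hA).1 hab _ _ hxy, inner_conj_symm]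

/-- `I + A^* A` is onto for a closed densely defined operator `A`. -/
theorem exists_mem_graph_mem_graph_adjoint [CompleteSpace E] [CompleteSpace F] {A : E →ₗ.[𝕜] F}
    (hA : Dense (A.domain : Set E)) (hc : A.IsClosed) (x : E) :
    ∃ y z, (y, z) ∈ A.graph ∧ (z, x - y) ∈ A.adjoint.graph := by
  -- The residual `(x - y, -z)` is orthogonal to the graph of `A`, which says `A* z = x - y`.
  obtain ⟨y, z, h, ho⟩ := exists_mem_inner_sub_eq_zero hc x 0
  refine ⟨y, z, h, (mem_graph_adjoint hA).2 fun a b hab => ?_⟩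
  have := ho a b hab
  rw [zero_sub, inner_neg_right] at this
  linear_combination -this

/-- The domain of `A^* A` is a core of the closed densely defined operator `A`. -/
theorem mem_closure_graph_adjoint_comp_self [CompleteSpace E] [CompleteSpace F] {A : E →ₗ.[𝕜] F}
    (hA : Dense (A.domain : Set E)) (hc : A.IsClosed) {x : E} {y : F} (hxy : (x, y) ∈ A.graph) :
    (x, y) ∈ closure {p : E × F | p ∈ A.graph ∧ ∃ z, (p.2, z) ∈ A.adjoint.graph} := by
  let K : Submodule 𝕜 (E × F) :=
    A.graph ⊓ A.adjoint.domain.comap (LinearMap.snd 𝕜 E F)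
  have hmem : ∀ p : E × F, p ∈ K ↔ p ∈ A.graph ∧ ∃ z, (p.2, z) ∈ A.adjoint.graph := by
    intro p
    rw [Submodule.mem_inf, Submodule.mem_comap, LinearMap.snd_apply, mem_domain_iff]
  suffices h : (x, y) ∈ K.topologicalClosure by
    rw [← SetLike.mem_coe, Submodule.topologicalClosure_coe] at h
    convert h using 2
    ext p
    exact (hmem p).symm
  apply mem_topologicalClosure_of_forall_inner
  intro u v huv
  -- The component `(u', v')` of `(u, v)` along the graph of `A` is still orthogonal to `K`. Testing
  -- it against `w` with `(I + A* A) w = u'` gives `⟪u', u'⟫ = 0`, so this component vanishes.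
  obtain ⟨u', v', hm, ho⟩ := exists_mem_inner_sub_eq_zero hc u v
  obtain ⟨w, z, hwz, hz⟩ := exists_mem_graph_mem_graph_adjoint hA hc u'
  have h₁ := huv w z ((hmem _).2 ⟨hwz, _, hz⟩)
  have h₂ := ho w z hwz
  rw [inner_sub_right, inner_sub_right] at h₂
  have h₃ := (mem_graph_adjoint hA).1 hz _ _ hm
  rw [inner_sub_right] at h₃
  have h₄ : inner 𝕜 u' u' = 0 := by
    have : (inner 𝕜 u' w + inner 𝕜 v' z : 𝕜) = 0 := by
      have : (inner 𝕜 w u' + inner 𝕜 z v' : 𝕜) = 0 := by linear_combination h₁ - h₂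
      rw [← inner_conj_symm, ← inner_conj_symm v', ← map_add, this, map_zero]
    linear_combination this - h₃
  rw [inner_self_eq_zero] at h₄
  subst h₄
  obtain rfl : v' = 0 := A.graph_fst_eq_zero_snd hm rfl
  simpa using ho x y hxy

/-- The operator `A^* A` determines the domain of `A` and the norms `‖A x‖`. -/
theorem exists_mem_graph_norm_eq [CompleteSpace E] [CompleteSpace F] [CompleteSpace G]
    {A : E →ₗ.[𝕜] F} {B : E →ₗ.[𝕜] G} (hA : Dense (A.domain : Set E)) (hcA : A.IsClosed)
    (hB : Dense (B.domain : Set E)) (hcB : B.IsClosed)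
    (h : pcomp A.adjoint A = pcomp B.adjoint B) {x : E} {y : F} (hxy : (x, y) ∈ A.graph) :
    ∃ z, (x, z) ∈ B.graph ∧ ‖z‖ = ‖y‖ := by
  obtain ⟨p, hp, hlim⟩ := mem_closure_iff_seq_limit.1 (mem_closure_graph_adjoint_comp_self hA hcA hxy)
  -- On the common domain of `A* A` and `B* B`, both `‖A a‖²` and `‖B a‖²` equal `⟪a, A* A a⟫`. The
  -- core property then carries this to all of `dom A`.
  have key : ∀ a b, (a, b) ∈ A.graph → (∃ z, (b, z) ∈ A.adjoint.graph) →
      ∃ c, (a, c) ∈ B.graph ∧ (∃ z, (c, z) ∈ B.adjoint.graph) ∧ ‖c‖ = ‖b‖ := by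
    rintro a b hab ⟨z, hz⟩
    have hz' : (a, z) ∈ (pcomp A.adjoint A).graph := mem_graph_pcomp.2 ⟨b, hab, hz⟩
    rw [h] at hz'
    obtain ⟨c, hac, hcz⟩ := mem_graph_pcomp.1 hz'
    refine ⟨c, hac, ⟨z, hcz⟩, ?_⟩
    have h₁ := (mem_graph_adjoint hA).1 hz _ _ hab
    have h₂ := (mem_graph_adjoint hB).1 hcz _ _ hac
    rw [inner_self_eq_norm_sq_to_K] at h₁ h₂
    have h₃ : ‖c‖ ^ 2 = ‖b‖ ^ 2 := by
      have := h₂.trans h₁.symm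
      exact_mod_cast this
    exact (sq_eq_sq₀ (norm_nonneg _) (norm_nonneg _)).1 h₃
  choose q hq hq' hqn using fun n => key (p n).1 (p n).2 (hp n).1 (hp n).2
  have hsub : ∀ m n, ‖q m - q n‖ = ‖(p m).2 - (p n).2‖ := by
    intro m n
    obtain ⟨z₁, hz₁⟩ := (hp m).2
    obtain ⟨z₂, hz₂⟩ := (hp n).2
    obtain ⟨c, hc, -, hcn⟩ := key _ _ (A.graph.sub_mem (hp m).1 (hp n).1)
      ⟨_, A.adjoint.graph.sub_mem hz₁ hz₂⟩
    have : c = q m - q n :=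
      B.mem_graph_snd_inj hc (B.graph.sub_mem (hq m) (hq n)) rfl
    rw [← this, hcn]
  have h₁ : Tendsto (fun n => (p n).1) atTop (𝓝 x) := (continuous_fst.tendsto _).comp hlim
  have h₂ : Tendsto (fun n => (p n).2) atTop (𝓝 y) := (continuous_snd.tendsto _).comp hlim
  have hcau : CauchySeq q := by
    have := h₂.cauchySeq
    rw [Metric.cauchySeq_iff] at this ⊢
    simpa only [dist_eq_norm, hsub] using this
  obtain ⟨z, hz⟩ := cauchySeq_tendsto_of_complete hcau
  refine ⟨z, ?_, ?_⟩
  · exact hcB.mem_of_tendsto (h₁.prodMk_nhds hz) (Eventually.of_forall hq)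
  · exact tendsto_nhds_unique (hz.norm) (by simpa only [hqn] using h₂.norm)

end Graph

/-! ### Positive self-adjoint operators and their resolvents. -/

section Positive

variable {𝕜 : Type*} [RCLike 𝕜] {H : Type*} [NormedAddCommGroup H] [InnerProductSpace 𝕜 H]

theorem isPositiveSymmetric_iff_graph {S : H →ₗ.[𝕜] H} :
    IsPositiveSymmetric S ↔
      (∀ a b c d, (a, b) ∈ S.graph → (c, d) ∈ S.graph → inner 𝕜 b c = inner 𝕜 a d) ∧
      ∀ a b, (a, b) ∈ S.graph → 0 ≤ RCLike.re (inner 𝕜 b a) := by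
  constructor
  · intro h
    constructor
    · intro a b c d hab hcd
      obtain ⟨f, rfl, rfl⟩ := (mem_graph_iff _).1 hab
      obtain ⟨g, rfl, rfl⟩ := (mem_graph_iff _).1 hcd
      exact h.symm f g
    · intro a b hab
      obtain ⟨f, rfl, rfl⟩ := (mem_graph_iff _).1 hab
      exact h.nonneg f
  · rintro ⟨h₁, h₂⟩
    exact ⟨fun f g => h₁ _ _ _ _ (S.mem_graph f) (S.mem_graph g), fun f => h₂ _ _ (S.mem_graph f)⟩

/-- The hypothesis encodes `(I + S) y = x`, as it does throughout. In `‖x‖² = ‖S y + y‖²` the cross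
term is nonnegative, so both `(I + S)⁻¹` and its complement are contractions. -/
theorem norm_le_norm_of_mem_graph {S : H →ₗ.[𝕜] H} (hS : IsPositiveSymmetric S) {x y : H}
    (h : (y, x - y) ∈ S.graph) : ‖y‖ ≤ ‖x‖ ∧ ‖x - y‖ ≤ ‖x‖ := by
  have h₁ := (isPositiveSymmetric_iff_graph.1 hS).2 _ _ h
  have h₂ : ‖x‖ ^ 2 = ‖x - y‖ ^ 2 + 2 * RCLike.re (inner 𝕜 (x - y) y) + ‖y‖ ^ 2 := by
    rw [← norm_add_sq (𝕜 := 𝕜), sub_add_cancel]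
  constructor <;> apply le_of_sq_le_sq _ (norm_nonneg _) <;> nlinarith [sq_nonneg ‖y‖, sq_nonneg ‖x - y‖]

/-- A positive symmetric operator `S` with `I + S` onto is self-adjoint. -/
theorem isSelfAdjoint_of_surjective [CompleteSpace H] {S : H →ₗ.[𝕜] H} (hS : IsPositiveSymmetric S)
    (h : ∀ x, ∃ y, (y, x - y) ∈ S.graph) : IsSelfAdjoint S := by
  have hg := isPositiveSymmetric_iff_graph.1 hS
  have hd : Dense (S.domain : Set H) := by
    rw [Submodule.dense_iff_topologicalClosure_eq_top, Submodule.topologicalClosure_eq_top_iff,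
      Submodule.eq_bot_iff]
    intro u hu
    -- For `u ⊥ dom S` and `(I + S) y = u`, positivity reads `0 ≤ ⟪u - y, y⟫ = -‖y‖²`.
    obtain ⟨y, hy⟩ := h u
    have h₀ : inner 𝕜 u y = 0 := by
      rw [← inner_conj_symm, hu y (mem_domain_of_mem_graph hy), map_zero]
    have h₁ := hg.2 _ _ hy
    rw [inner_sub_left, h₀, zero_sub, map_neg, inner_self_eq_norm_sq] at h₁
    have h₂ : y = 0 := by
      rw [← norm_eq_zero]
      nlinarith [sq_nonneg ‖y‖]
    subst h₂
    simpa using S.graph_fst_eq_zero_snd hy rfl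
  rw [isSelfAdjoint_def]
  apply eq_of_eq_graph
  apply le_antisymm
  · rintro ⟨u, v⟩ huv
    rw [mem_graph_adjoint hd] at huv
    obtain ⟨y, hy⟩ := h (u + v)
    suffices hu : u = y by
      subst hu
      simpa using hy
    -- Both `(u, v)` and `(y, u + v - y)` lie in the graph of `S*`, so `u - y` is orthogonal to `ran
    -- (I + S)`, hence to itself.
    obtain ⟨w, hw⟩ := h (u - y)
    rw [← sub_eq_zero, ← inner_self_eq_zero (𝕜 := 𝕜)]
    have h₁ := huv _ _ hw
    have h₂ := hg.1 _ _ _ _ hw hy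
    rw [inner_sub_left] at h₁ h₂
    rw [inner_sub_right] at h₂
    rw [inner_sub_right]
    rw [inner_add_right] at h₂
    linear_combination h₁ - h₂
  · rintro ⟨u, v⟩ huv
    rw [mem_graph_adjoint hd]
    exact fun a b hab => hg.1 _ _ _ _ hab huv

/-- `I + S` is onto for a positive self-adjoint operator `S`. -/
theorem exists_mem_graph_sub [CompleteSpace H] {S : H →ₗ.[𝕜] H} (hS : IsPositiveSymmetric S)
    (hsa : IsSelfAdjoint S) (x : H) : ∃ y, (y, x - y) ∈ S.graph := by
  have hg := isPositiveSymmetric_iff_graph.1 hS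
  -- `Φ` is `I + S` viewed on the complete graph of `S`; being bounded below, it has closed range. A
  -- vector `u` orthogonal to that range satisfies `S u = -u`, which forces `u = 0`.
  let Φ : S.graph →L[𝕜] H :=
    (ContinuousLinearMap.fst 𝕜 H H + ContinuousLinearMap.snd 𝕜 H H).comp S.graph.subtypeL
  have hΦ : ∀ p : S.graph, Φ p = p.1.1 + p.1.2 := fun p => rfl
  have hanti : AntilipschitzWith 1 Φ := by
    apply AddMonoidHomClass.antilipschitz_of_bound
    intro p
    have hp : (p.1.1, Φ p - p.1.1) ∈ S.graph := by
      rw [hΦ, add_sub_cancel_left]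
      exact p.2
    have := norm_le_norm_of_mem_graph hS hp
    rw [hΦ, add_sub_cancel_left] at this
    rw [NNReal.coe_one, one_mul, hΦ]
    exact max_le this.1 this.2
  have : CompleteSpace S.graph := hsa.isClosed.completeSpace_coe
  have hcl : IsClosed (LinearMap.range Φ.toLinearMap : Set H) :=
    hanti.isClosed_range Φ.uniformContinuous
  have htop : LinearMap.range Φ.toLinearMap = ⊤ := by
    rw [← hcl.submodule_topologicalClosure_eq, Submodule.topologicalClosure_eq_top_iff,
      Submodule.eq_bot_iff]
    intro u hu
    have hmem : (u, -u) ∈ S.graph := by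
      nth_rw 1 [← isSelfAdjoint_def.1 hsa]
      rw [mem_graph_adjoint hsa.dense_domain]
      intro a b hab
      have := hu _ ⟨⟨(a, b), hab⟩, rfl⟩
      change inner 𝕜 (a + b) u = 0 at this
      rw [inner_add_left] at this
      rw [inner_neg_right]
      linear_combination this
    have := hg.2 _ _ hmem
    rw [inner_neg_left, map_neg, inner_self_eq_norm_sq] at this
    rw [← norm_eq_zero]
    nlinarith [sq_nonneg ‖u‖]
  obtain ⟨p, hp⟩ : x ∈ LinearMap.range Φ.toLinearMap := htop ▸ Submodule.mem_top
  refine ⟨p.1.1, ?_⟩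
  rw [← hp]
  change (p.1.1, p.1.1 + p.1.2 - p.1.1) ∈ _
  rw [add_sub_cancel_left]
  exact p.2

/-- The resolvent `(I + S)⁻¹` as a bounded operator. -/
theorem exists_resolvent [CompleteSpace H] {S : H →ₗ.[𝕜] H} (hS : IsPositiveSymmetric S)
    (hsa : IsSelfAdjoint S) : ∃ C : H →L[𝕜] H, (∀ x, (C x, x - C x) ∈ S.graph) ∧
      ∀ x y, (y, x - y) ∈ S.graph → y = C x := by
  choose C hC using exists_mem_graph_sub hS hsa
  have huniq : ∀ x y, (y, x - y) ∈ S.graph → y = C x := by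
    intro x y hy
    have h : (y - C x, 0 - (y - C x)) ∈ S.graph := by
      convert S.graph.sub_mem hy (hC x) using 1
      simp
    have := (norm_le_norm_of_mem_graph hS h).1
    rw [norm_zero, norm_le_zero_iff, sub_eq_zero] at this
    exact this
  let C' : H →ₗ[𝕜] H :=
    { toFun := C
      map_add' := fun x y => by
        refine (huniq _ _ ?_).symm
        convert S.graph.add_mem (hC x) (hC y) using 1
        simp only [Prod.mk_add_mk, Prod.mk.injEq, true_and]
        abel
      map_smul' := fun c x => by
        refine (huniq _ _ ?_).symm
        convert S.graph.smul_mem c (hC x) using 1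
        simp [smul_sub] }
  exact ⟨C'.mkContinuous 1 fun x => by
    rw [one_mul]; exact (norm_le_norm_of_mem_graph hS (hC x)).1, hC, huniq⟩

/-- Translates the graph form of `(I + S) y = x` into `invOneAdd`; injectivity of `I + S` is what
makes `inverse` a true inverse. -/
theorem invOneAdd_apply {S : H →ₗ.[𝕜] H} (hS : IsPositiveSymmetric S) {x y : H}
    (h : (y, x - y) ∈ S.graph) :
    ∃ hx : x ∈ (invOneAdd S).domain, invOneAdd S ⟨x, hx⟩ = y := by
  have hker : LinearMap.ker (((LinearMap.id : H →ₗ[𝕜] H) +ᵥ S).toFun) = ⊥ := by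
    rw [LinearMap.ker_eq_bot']
    intro z hz
    have hz' : (z : H) + S z = 0 := hz
    have hm : ((z : H), (0 : H) - z) ∈ S.graph := by
      rw [← hz', add_sub_cancel_left]
      exact S.mem_graph z
    have := (norm_le_norm_of_mem_graph hS hm).1
    rw [norm_zero, norm_le_zero_iff] at this
    exact Subtype.ext this
  obtain ⟨z, hz, hz'⟩ := (mem_graph_iff _).1 h
  have hz'' : ((LinearMap.id : H →ₗ[𝕜] H) +ᵥ S) z = x := by
    change (z : H) + S z = x
    rw [hz', hz]
    exact add_sub_cancel y x
  have hx : x ∈ (invOneAdd S).domain := by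
    rw [invOneAdd, inverse_domain]
    exact ⟨z, hz''⟩
  exact ⟨hx, (inverse_apply_eq hker (y := ⟨x, hx⟩) hz'').trans hz⟩

end Positive

/-! ### Bounded square roots by iteration. -/

section Sqrt

/-- Square roots in a Banach algebra by the monotone iteration for `Y = (X + Y ^ 2) / 2`. -/
theorem exists_sqrt_of_norm_one_sub_le (𝕜 : Type*) [RCLike 𝕜] {A : Type*} [NormedRing A]
    [NormedAlgebra 𝕜 A] [CompleteSpace A] [StarRing A] [ContinuousStar A] [StarModule 𝕜 A]
    {B : A} (hB : IsSelfAdjoint B) (hn : ‖1 - B‖ ≤ 1) :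
    ∃ D : A, IsSelfAdjoint D ∧ ‖1 - D‖ ≤ 1 ∧ D * D = B ∧
      ∀ Z, Commute Z B → Commute Z D := by
  let X := 1 - B
  let Y : ℕ → A := fun n => Nat.rec 0 (fun _ Y => (2⁻¹ : 𝕜) • (X + Y * Y)) n
  -- The scalar case `X = 1` majorizes both `‖Y n‖` and the increments of `Y`. Its increments
  -- telescope to at most `1`, so `Y` converges although the iteration need not be a strict
  -- contraction.
  let s : ℕ → ℝ := fun n => Nat.rec 0 (fun _ t => 2⁻¹ * (1 + t * t)) n
  have Y0 : Y 0 = 0 := rfl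
  have YS : ∀ n, Y (n + 1) = (2⁻¹ : 𝕜) • (X + Y n * Y n) := fun n => rfl
  have s0 : s 0 = 0 := rfl
  have sS : ∀ n, s (n + 1) = 2⁻¹ * (1 + s n * s n) := fun n => rfl
  have hhalf : ‖(2⁻¹ : 𝕜)‖ = 2⁻¹ := by simp
  have hs : ∀ n, 0 ≤ s n ∧ s n ≤ 1 := by
    intro n
    induction n with
    | zero => simp [s0]
    | succ n ih =>
      rw [sS]
      constructor <;> nlinarith [ih.1, ih.2]
  have hY : ∀ n, ‖Y n‖ ≤ s n := by
    intro n
    induction n with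
    | zero => simp [s0, Y0]
    | succ n ih =>
      rw [sS, YS, norm_smul, hhalf]
      gcongr
      refine (norm_add_le _ _).trans (add_le_add hn ((norm_mul_le _ _).trans ?_))
      exact mul_le_mul ih ih (norm_nonneg _) (hs n).1
  have hd : ∀ n, ‖Y (n + 1) - Y n‖ ≤ s (n + 1) - s n := by
    intro n
    induction n with
    | zero =>
      have := hY 1
      simpa [Y0, s0] using this
    | succ n ih =>
      have e₁ : Y (n + 1 + 1) - Y (n + 1) =
          (2⁻¹ : 𝕜) • ((Y (n + 1) - Y n) * Y (n + 1) + Y n * (Y (n + 1) - Y n)) := by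
        rw [YS (n + 1)]
        nth_rw 3 [YS n]
        rw [← smul_sub]
        congr 1
        noncomm_ring
      have e₂ : s (n + 1 + 1) - s (n + 1) =
          2⁻¹ * ((s (n + 1) - s n) * s (n + 1) + s n * (s (n + 1) - s n)) := by
        rw [sS (n + 1)]
        nth_rw 3 [sS n]
        ring
      rw [e₁, e₂, norm_smul, hhalf]
      have h0 := (norm_nonneg _).trans ih
      gcongr
      refine (norm_add_le _ _).trans (add_le_add ((norm_mul_le _ _).trans ?_)
        ((norm_mul_le _ _).trans ?_))
      · exact mul_le_mul ih (hY (n + 1)) (norm_nonneg _) h0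
      · exact mul_le_mul (hY n) ih (norm_nonneg _) (hs n).1
  have hsum : Summable fun n => s (n + 1) - s n := by
    refine summable_of_sum_range_le (c := 1) (fun n => (norm_nonneg _).trans (hd n)) fun n => ?_
    rw [Finset.sum_range_sub, s0, sub_zero]
    exact (hs n).2
  have hcau : CauchySeq Y := cauchySeq_of_dist_le_of_summable _
    (fun n => by rw [dist_comm, dist_eq_norm]; exact hd n) hsum
  obtain ⟨L, hL⟩ := cauchySeq_tendsto_of_complete hcau
  have hfix : L = (2⁻¹ : 𝕜) • (X + L * L) :=
    tendsto_nhds_unique ((tendsto_add_atTop_iff_nat 1).2 hL)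
      (((hL.mul hL).const_add X).const_smul (2⁻¹ : 𝕜))
  have hfix2 : L + L = X + L * L := by
    have := congrArg (fun t => (2 : 𝕜) • t) hfix
    simpa [two_smul, smul_smul] using this
  have hXs : IsSelfAdjoint X := (IsSelfAdjoint.one _).sub hB
  have hYs : ∀ n, IsSelfAdjoint (Y n) := by
    intro n
    induction n with
    | zero => exact IsSelfAdjoint.zero _
    | succ n ih =>
      rw [YS, isSelfAdjoint_iff, star_smul, star_add, star_mul, ih.star_eq, hXs.star_eq]
      simp
  have hLs : IsSelfAdjoint L := by
    rw [isSelfAdjoint_iff]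
    exact tendsto_nhds_unique ((continuous_star.tendsto L).comp hL)
      (hL.congr fun n => (hYs n).star_eq.symm)
  have hYc : ∀ Z, Commute Z B → ∀ n, Commute Z (Y n) := by
    intro Z hZ n
    induction n with
    | zero => exact Commute.zero_right _
    | succ n ih =>
      exact (((Commute.one_right Z).sub_right hZ).add_right (ih.mul_right ih)).smul_right _
  -- The fixed-point equation `2 L = X + L²` says `(1 - L)² = 1 - X = B`.
  refine ⟨1 - L, (IsSelfAdjoint.one _).sub hLs, ?_, ?_, fun Z hZ => ?_⟩
  · rw [sub_sub_cancel]
    exact le_of_tendsto hL.norm (Eventually.of_forall fun n => (hY n).trans (hs n).2)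
  · have : (1 - L) * (1 - L) = 1 - (L + L) + L * L := by noncomm_ring
    rw [this, hfix2, sub_add_eq_sub_sub, sub_add_cancel, sub_sub_cancel]
  · refine (Commute.one_right Z).sub_right ?_
    exact tendsto_nhds_unique (hL.const_mul Z)
      ((hL.mul_const Z).congr fun n => (hYc Z hZ n).eq.symm)

end Sqrt

/-! ### Square roots of unbounded positive self-adjoint operators. -/

section UnboundedSqrt

variable {𝕜 : Type*} [RCLike 𝕜] {H : Type*} [NormedAddCommGroup H] [InnerProductSpace 𝕜 H]

/-- `⟪S x, x⟫ = ‖x‖² - ⟪(1 - S) x, x⟫`; thus the norm bound on the bounded square roots encodes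
their positivity. -/
theorem re_inner_nonneg_of_norm_one_sub_le {S : H →L[𝕜] H} (hS : ‖1 - S‖ ≤ 1) (x : H) :
    0 ≤ RCLike.re (inner 𝕜 (S x) x) := by
  have h₁ : RCLike.re (inner 𝕜 ((1 - S) x) x) ≤ ‖x‖ * ‖x‖ :=
    (re_inner_le_norm _ _).trans (mul_le_mul_of_nonneg_right
      (((1 - S).le_of_opNorm_le hS x).trans_eq (one_mul _)) (norm_nonneg _))
  have h₂ : (1 - S) x = x - S x := rfl
  rw [h₂, inner_sub_left, map_sub, inner_self_eq_norm_sq] at h₁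
  nlinarith

/-- A positive self-adjoint operator has a positive self-adjoint square root. -/
theorem exists_isPositiveSqrt [CompleteSpace H] {A : H →ₗ.[𝕜] H} (hA : IsPositiveSymmetric A)
    (hsa : IsSelfAdjoint A) : ∃ R, IsPositiveSqrt R A := by
  have hg := isPositiveSymmetric_iff_graph.1 hA
  obtain ⟨C, hC, hCu⟩ := exists_resolvent hA hsa
  have hCs : IsSelfAdjoint C := by
    rw [ContinuousLinearMap.isSelfAdjoint_iff_isSymmetric]
    intro x y
    have := hg.1 _ _ _ _ (hC x) (hC y)
    rw [inner_sub_left, inner_sub_right] at this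
    change inner 𝕜 (C x) y = inner 𝕜 x (C y)
    linear_combination -this
  have hCn : ‖C‖ ≤ 1 := C.opNorm_le_bound zero_le_one fun x => by
    rw [one_mul]
    exact (norm_le_norm_of_mem_graph hA (hC x)).1
  have hCn' : ‖1 - C‖ ≤ 1 := (1 - C).opNorm_le_bound zero_le_one fun x => by
    rw [one_mul]
    exact (norm_le_norm_of_mem_graph hA (hC x)).2
  -- With `C = (I + A)⁻¹`, formally `A = (1 - C) C⁻¹`. So take `D = C^{1/2}`, `S = (1 - C)^{1/2}`
  -- and `R = S D⁻¹`, with graph `{(D x, S x)}`. The further root `W = D^{1/2}` gives positivity: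
  -- `⟪S x, D x⟫ = ⟪S W x, W x⟫`.
  obtain ⟨D, hDs, hDn, hD, hDc⟩ := exists_sqrt_of_norm_one_sub_le 𝕜 hCs hCn'
  obtain ⟨S, hSs, hSn, hS, hSc⟩ := exists_sqrt_of_norm_one_sub_le 𝕜
    ((IsSelfAdjoint.one (H →L[𝕜] H)).sub hCs) (by rwa [sub_sub_cancel])
  obtain ⟨W, hWs, -, hW, hWc⟩ := exists_sqrt_of_norm_one_sub_le 𝕜 hDs hDn
  have hSD' : Commute S D :=
    hDc S (hSc C ((Commute.one_right C).sub_right (Commute.refl C))).symm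
  have hDD : ∀ x, D (D x) = C x := fun x => DFunLike.congr_fun hD x
  have hSS : ∀ x, S (S x) = x - C x := fun x => DFunLike.congr_fun hS x
  have hWW : ∀ x, W (W x) = D x := fun x => DFunLike.congr_fun hW x
  have hSD : ∀ x, S (D x) = D (S x) := fun x => DFunLike.congr_fun hSD'.eq x
  have hSW : ∀ x, S (W x) = W (S x) := fun x => DFunLike.congr_fun (hWc S hSD').eq x
  have iD : ∀ x y, inner 𝕜 (D x) y = inner 𝕜 x (D y) :=
    ContinuousLinearMap.isSelfAdjoint_iff_isSymmetric.1 hDs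
  have iS : ∀ x y, inner 𝕜 (S x) y = inner 𝕜 x (S y) :=
    ContinuousLinearMap.isSelfAdjoint_iff_isSymmetric.1 hSs
  have iW : ∀ x y, inner 𝕜 (W x) y = inner 𝕜 x (W y) :=
    ContinuousLinearMap.isSelfAdjoint_iff_isSymmetric.1 hWs
  have hDinj : ∀ x, D x = 0 → x = 0 := by
    intro x hx
    have h₁ := hC x
    rw [← hDD, hx, map_zero, sub_zero] at h₁
    exact A.graph_fst_eq_zero_snd h₁ rfl
  let R : H →ₗ.[𝕜] H := (LinearMap.range (D.prod S).toLinearMap).toLinearPMap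
  have hR : ∀ a b, (a, b) ∈ R.graph ↔ ∃ x, D x = a ∧ S x = b := by
    intro a b
    rw [Submodule.toLinearPMap_graph_eq]
    · simp
    · rintro p ⟨x, rfl⟩ hx
      have hx : D x = 0 := hx
      change S x = 0
      rw [hDinj x hx, map_zero]
  have hRpos : IsPositiveSymmetric R := by
    rw [isPositiveSymmetric_iff_graph]
    constructor
    · intro a b c d hab hcd
      obtain ⟨x, rfl, rfl⟩ := (hR _ _).1 hab
      obtain ⟨y, rfl, rfl⟩ := (hR _ _).1 hcd
      rw [iS, hSD, iD]
    · intro a b hab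
      obtain ⟨x, rfl, rfl⟩ := (hR _ _).1 hab
      rw [← hWW, ← iW, ← hSW]
      exact re_inner_nonneg_of_norm_one_sub_le hSn _
  have hRd : Dense (R.domain : Set H) := by
    refine hsa.dense_domain.mono fun a ha => ?_
    obtain ⟨b, hb⟩ := mem_domain_iff.1 ha
    have : a = C (a + b) := hCu _ _ (by rwa [add_sub_cancel_left])
    refine mem_domain_iff.2 ⟨_, (hR _ _).2 ⟨D (a + b), ?_, rfl⟩⟩
    rw [hDD, ← this]
  refine ⟨R, hRpos, ?_, ?_⟩
  · rw [isSelfAdjoint_def]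
    apply eq_of_eq_graph
    apply le_antisymm
    · rintro ⟨u, v⟩ huv
      rw [mem_graph_adjoint hRd] at huv
      have h : S u = D v := by
        refine ext_inner_left 𝕜 fun x => ?_
        rw [← iS, ← iD]
        exact huv _ _ ((hR _ _).2 ⟨x, rfl, rfl⟩)
      -- Since `D² + S² = 1`, the vector `x` with `u = D x` and `v = S x` must be `D u + S v`.
      refine (hR _ _).2 ⟨S v + D u, ?_, ?_⟩
      · rw [map_add, hDD, ← hSD, ← h, hSS, sub_add_cancel]
      · rw [map_add, hSS, hSD, h, hDD, sub_add_cancel]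
    · rintro ⟨u, v⟩ huv
      rw [mem_graph_adjoint hRd]
      exact fun a b hab => (isPositiveSymmetric_iff_graph.1 hRpos).1 _ _ _ _ hab huv
  · apply eq_of_eq_graph
    apply le_antisymm
    · rintro ⟨a, c⟩ h
      obtain ⟨m, h₁, h₂⟩ := mem_graph_pcomp.1 h
      obtain ⟨x, rfl, rfl⟩ := (hR _ _).1 h₁
      obtain ⟨z, hz, rfl⟩ := (hR _ _).1 h₂
      -- Here `R (D x) = S x = D z` and `R (D z) = S z`; the resolvent identity at `D x + S z` then
      -- gives `A (D x) = S z`.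
      have : C (D x + S z) = D x := by
        rw [← hDD, map_add, ← hSD z, hz, hSS, hDD, add_sub_cancel]
      have h := hC (D x + S z)
      rwa [this, add_sub_cancel_left] at h
    · rintro ⟨a, b⟩ hab
      have ha : a = C (a + b) := hCu _ _ (by rwa [add_sub_cancel_left])
      refine mem_graph_pcomp.2 ⟨S (D (a + b)), (hR _ _).2 ⟨D (a + b), ?_, rfl⟩,
        (hR _ _).2 ⟨S (a + b), (hSD _).symm, ?_⟩⟩
      · rw [hDD, ← ha]
      · rw [hSS, ← ha, add_sub_cancel_left]

end UnboundedSqrt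

/-! ### Positivity and maximality of `A* A`. -/

section AdjointCompSelf

variable {𝕜 : Type*} [RCLike 𝕜] {H E : Type*} [NormedAddCommGroup H] [InnerProductSpace 𝕜 H]
  [CompleteSpace H] [NormedAddCommGroup E] [InnerProductSpace 𝕜 E]

theorem isPositiveSymmetric_adjoint_comp_self {A : H →ₗ.[𝕜] E}
    (hA : Dense (A.domain : Set H)) : IsPositiveSymmetric (pcomp A.adjoint A) := by
  rw [isPositiveSymmetric_iff_graph]
  have key : ∀ a b c y, (c, y) ∈ A.graph → ∀ x, (a, x) ∈ A.graph → (x, b) ∈ A.adjoint.graph →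
      inner 𝕜 b c = inner 𝕜 x y := by
    intro a b c y hcy x _ hxb
    rw [← inner_conj_symm, ← (mem_graph_adjoint hA).1 hxb _ _ hcy, inner_conj_symm]
  constructor
  · intro a b c d hab hcd
    obtain ⟨x, hax, hxb⟩ := mem_graph_pcomp.1 hab
    obtain ⟨y, hcy, hyd⟩ := mem_graph_pcomp.1 hcd
    rw [key _ _ _ _ hcy _ hax hxb, (mem_graph_adjoint hA).1 hyd _ _ hax]
  · intro a b hab
    obtain ⟨x, hax, hxb⟩ := mem_graph_pcomp.1 hab
    rw [key _ _ _ _ hax _ hax hxb]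
    exact inner_self_nonneg

theorem exists_mem_graph_adjoint_comp_self [CompleteSpace E] {A : H →ₗ.[𝕜] E}
    (hA : Dense (A.domain : Set H)) (hc : A.IsClosed) (x : H) :
    ∃ y, (y, x - y) ∈ (pcomp A.adjoint A).graph := by
  obtain ⟨y, z, h₁, h₂⟩ := exists_mem_graph_mem_graph_adjoint hA hc x
  exact ⟨y, mem_graph_pcomp.2 ⟨z, h₁, h₂⟩⟩

/-- If the form of `S` extends that of `A^* A` from a core of `A`, then `S ⪯ A^* A`. -/
theorem formLE_adjoint_comp_self [CompleteSpace E] {A : H →ₗ.[𝕜] E}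
    (hA : Dense (A.domain : Set H)) (hc : A.IsClosed) {S : H →ₗ.[𝕜] H}
    (hS : IsPositiveSymmetric S) (hsa : IsSelfAdjoint S)
    (hcore : (A.graph : Set (H × E)) ⊆ closure {p | ∃ c, (p.1, c) ∈ S.graph ∧
      RCLike.re (inner 𝕜 c p.1) = ‖p.2‖ ^ 2}) : FormLE S (pcomp A.adjoint A) := by
  intro x
  have hg := isPositiveSymmetric_iff_graph.1 hS
  obtain ⟨z, hz⟩ := exists_mem_graph_sub hS hsa x
  obtain ⟨y, w, hyw, hw⟩ := exists_mem_graph_mem_graph_adjoint hA hc x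
  obtain ⟨h₁, e₁⟩ := invOneAdd_apply hS hz
  obtain ⟨h₂, e₂⟩ := invOneAdd_apply (isPositiveSymmetric_adjoint_comp_self hA)
    (mem_graph_pcomp.2 ⟨w, hyw, hw⟩)
  refine ⟨h₁, h₂, ?_⟩
  rw [e₁, e₂]
  -- For `v ∈ dom S` this is `⟪(I + S)(z - v), z - v⟫ ≥ 0` expanded with `(I + S) z = x`. Written
  -- with `‖p.2‖²` in place of the form of `S`, the inequality is closed in `p`.
  have key : ∀ p ∈ closure {p : H × E | ∃ c, (p.1, c) ∈ S.graph ∧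
      RCLike.re (inner 𝕜 c p.1) = ‖p.2‖ ^ 2},
      2 * RCLike.re (inner 𝕜 p.1 x) - ‖p.1‖ ^ 2 - ‖p.2‖ ^ 2 ≤ RCLike.re (inner 𝕜 z x) := by
    have hcl : IsClosed {p : H × E | 2 * RCLike.re (inner 𝕜 p.1 x) - ‖p.1‖ ^ 2 - ‖p.2‖ ^ 2 ≤
        RCLike.re (inner 𝕜 z x)} := by
      refine isClosed_le ?_ continuous_const
      have : Continuous fun p : H × E => RCLike.re (inner 𝕜 p.1 x) :=
        RCLike.continuous_re.comp (continuous_fst.inner continuous_const)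
      fun_prop
    refine hcl.closure_subset_iff.2 ?_
    rintro ⟨v, e⟩ ⟨c, hvc, hce⟩
    change RCLike.re (inner 𝕜 c v) = ‖e‖ ^ 2 at hce
    change 2 * RCLike.re (inner 𝕜 v x) - ‖v‖ ^ 2 - ‖e‖ ^ 2 ≤ RCLike.re (inner 𝕜 z x)
    have i₁ := hg.2 _ _ (S.graph.sub_mem hz hvc)
    have i₂ : 0 ≤ RCLike.re (inner 𝕜 (z - v) (z - v)) := inner_self_nonneg
    have i₃ := congrArg RCLike.re (hg.1 _ _ _ _ hvc hz)
    have s₁ := inner_re_symm (𝕜 := 𝕜) x z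
    have s₂ := inner_re_symm (𝕜 := 𝕜) x v
    have s₃ := inner_re_symm (𝕜 := 𝕜) v z
    have n₁ := inner_self_eq_norm_sq (𝕜 := 𝕜) v
    simp only [inner_sub_left, inner_sub_right, map_sub] at i₁ i₂ i₃
    linarith
  -- At `y = (I + A* A)⁻¹ x` and `w = A y`, one has `‖y‖² + ‖w‖² = re ⟪y, x⟫`, so the left side of
  -- `key` becomes `re ⟪y, x⟫`.
  have hk := key _ (hcore hyw)
  have h₃ := congrArg RCLike.re ((mem_graph_adjoint hA).1 hw _ _ hyw)
  rw [inner_self_eq_norm_sq, inner_sub_right, map_sub, inner_self_eq_norm_sq] at h₃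
  change 2 * RCLike.re (inner 𝕜 y x) - ‖y‖ ^ 2 - ‖w‖ ^ 2 ≤ RCLike.re (inner 𝕜 z x) at hk
  linarith

end AdjointCompSelf

/-! ### The energy operator and the Friedrichs extension. -/

section Friedrichs

variable {𝕜 : Type*} [RCLike 𝕜] {H : Type*} [NormedAddCommGroup H] [InnerProductSpace 𝕜 H]
  {T : H →ₗ.[𝕜] H} {hT : IsPositiveSymmetric T}

variable (T hT) in
/-- The operator `Q_T` as a linear map on `dom T`. -/
noncomputable def energyMap : T.domain →ₗ[𝕜] EnergySpace T hT :=
  (energyOp T hT).toFun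

theorem mem_graph_energyOp (a : H) (b : EnergySpace T hT) :
    (a, b) ∈ (energyOp T hT).graph ↔ ∃ f : T.domain, (f : H) = a ∧ energyMap T hT f = b :=
  mem_graph_iff _

theorem inner_energyMap (f h : T.domain) :
    inner 𝕜 (energyMap T hT f) (energyMap T hT h) = inner 𝕜 (T f) (h : H) :=
  (UniformSpace.Completion.inner_coe _ _).trans (energy_inner T hT f h)

theorem inner_apply_self (f : T.domain) :
    inner 𝕜 (T f) (f : H) = ((‖energyMap T hT f‖ ^ 2 : ℝ) : 𝕜) := by
  rw [← inner_energyMap (hT := hT), inner_self_eq_norm_sq_to_K]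
  norm_cast

variable [CompleteSpace H]

/-- `⟪Q_T f, Q_T h⟫ = ⟪T f, h⟫ = ⟪f, T h⟫`. This yields both the density of `dom Q_T*` and `T ⊆
T_F`. -/
theorem mem_graph_adjoint_energyOp (hd : Dense (T.domain : Set H)) (h : T.domain) :
    (energyMap T hT h, T h) ∈ (energyOp T hT).adjoint.graph := by
  rw [mem_graph_adjoint (A := energyOp T hT) hd]
  intro a b hab
  obtain ⟨f, rfl, rfl⟩ := (mem_graph_energyOp _ _).1 hab
  rw [inner_energyMap, hT.symm]

theorem dense_adjoint_energyOp_domain (hd : Dense (T.domain : Set H)) :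
    Dense ((energyOp T hT).adjoint.domain : Set (EnergySpace T hT)) := by
  refine UniformSpace.Completion.denseRange_coe.mono ?_
  rintro _ ⟨x, rfl⟩
  rw [← toEnergyRange_preimage T hT x]
  exact mem_domain_of_mem_graph (mem_graph_adjoint_energyOp hd (energyPreimage T hT x))

theorem graph_energyOp_adjoint_adjoint (hd : Dense (T.domain : Set H)) :
    (energyOp T hT).adjoint.adjoint.graph = (energyOp T hT).graph.topologicalClosure :=
  graph_adjoint_adjoint hd (dense_adjoint_energyOp_domain hd)

theorem mem_graph_energyOp_adjoint_adjoint (hd : Dense (T.domain : Set H)) (f : T.domain) :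
    ((f : H), energyMap T hT f) ∈ (energyOp T hT).adjoint.adjoint.graph := by
  rw [graph_energyOp_adjoint_adjoint hd]
  exact Submodule.le_topologicalClosure _ ((mem_graph_energyOp _ _).2 ⟨f, rfl, rfl⟩)

theorem dense_energyOp_adjoint_adjoint_domain (hd : Dense (T.domain : Set H)) :
    Dense ((energyOp T hT).adjoint.adjoint.domain : Set H) :=
  hd.mono fun f hf => mem_domain_of_mem_graph (mem_graph_energyOp_adjoint_adjoint hd ⟨f, hf⟩)

theorem isClosed_energyOp_adjoint_adjoint (hd : Dense (T.domain : Set H)) :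
    (energyOp T hT).adjoint.adjoint.IsClosed :=
  adjoint_isClosed (dense_adjoint_energyOp_domain hd)

/-- `Q_T*` is already closed, so its double adjoint is itself. This puts `T_F` in the form `A* A`
with `A = Q_T**`. -/
theorem energyOp_adjoint_adjoint_adjoint (hd : Dense (T.domain : Set H)) :
    (energyOp T hT).adjoint.adjoint.adjoint = (energyOp T hT).adjoint := by
  apply eq_of_eq_graph
  rw [graph_adjoint_adjoint (dense_adjoint_energyOp_domain hd)
    (dense_energyOp_adjoint_adjoint_domain hd)]
  exact (adjoint_isClosed (T := energyOp T hT) hd).submodule_topologicalClosure_eq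

theorem friedrichs_eq (hd : Dense (T.domain : Set H)) :
    friedrichs T hT =
      pcomp (energyOp T hT).adjoint.adjoint.adjoint (energyOp T hT).adjoint.adjoint := by
  rw [energyOp_adjoint_adjoint_adjoint hd, friedrichs]

theorem le_friedrichs (hd : Dense (T.domain : Set H)) : T ≤ friedrichs T hT := by
  apply le_of_le_graph
  rintro ⟨a, b⟩ hab
  obtain ⟨f, rfl, rfl⟩ := (mem_graph_iff _).1 hab
  exact mem_graph_pcomp.2 ⟨_, mem_graph_energyOp_adjoint_adjoint hd f,
    mem_graph_adjoint_energyOp hd f⟩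

theorem isPositiveSymmetric_friedrichs (hd : Dense (T.domain : Set H)) :
    IsPositiveSymmetric (friedrichs T hT) := by
  rw [friedrichs_eq hd]
  exact isPositiveSymmetric_adjoint_comp_self (dense_energyOp_adjoint_adjoint_domain hd)

theorem isSelfAdjoint_friedrichs (hd : Dense (T.domain : Set H)) :
    IsSelfAdjoint (friedrichs T hT) := by
  refine isSelfAdjoint_of_surjective (isPositiveSymmetric_friedrichs hd) ?_
  rw [friedrichs_eq hd]
  exact exists_mem_graph_adjoint_comp_self (dense_energyOp_adjoint_adjoint_domain hd)
    (isClosed_energyOp_adjoint_adjoint hd)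

/-- The graph of `Q_T` is dense in that of `Q_T**`, and on `dom T` every extension `S` has the form
`⟪T f, f⟫ = ‖Q_T f‖²`. -/
theorem formLE_friedrichs (hd : Dense (T.domain : Set H)) {S : H →ₗ.[𝕜] H}
    (hS : IsPositiveSymmetric S) (hsa : IsSelfAdjoint S) (hTS : T ≤ S) :
    FormLE S (friedrichs T hT) := by
  rw [friedrichs_eq hd]
  refine formLE_adjoint_comp_self (dense_energyOp_adjoint_adjoint_domain hd)
    (isClosed_energyOp_adjoint_adjoint hd) hS hsa ?_
  rw [graph_energyOp_adjoint_adjoint hd, Submodule.topologicalClosure_coe]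
  apply closure_mono
  rintro ⟨a, b⟩ hab
  obtain ⟨f, rfl, rfl⟩ := (mem_graph_energyOp _ _).1 hab
  refine ⟨T f, le_graph_of_le hTS (T.mem_graph f), ?_⟩
  rw [inner_apply_self (hT := hT), RCLike.ofReal_re]

/-- The energy condition says exactly that `Q_T (u n)` is Cauchy in the complete space `EnergySpace
T hT`; closedness of `Q_T**` identifies the limit. -/
theorem EnergyConverges.exists_tendsto (hd : Dense (T.domain : Set H)) {u : ℕ → T.domain} {g : H}
    (h : EnergyConverges T u g) : ∃ e, (g, e) ∈ (energyOp T hT).adjoint.adjoint.graph ∧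
      Tendsto (fun n => energyMap T hT (u n)) atTop (𝓝 e) := by
  have hcau : CauchySeq fun n => energyMap T hT (u n) := by
    rw [cauchySeq_iff_tendsto_dist_atTop_0]
    have h₁ := (RCLike.continuous_re.tendsto (0 : 𝕜)).comp h.2
    rw [map_zero] at h₁
    have h₂ := (Real.continuous_sqrt.tendsto 0).comp h₁
    rw [Real.sqrt_zero] at h₂
    refine h₂.congr fun p => ?_
    simp only [Function.comp_apply]
    rw [inner_apply_self (hT := hT), RCLike.ofReal_re, Real.sqrt_sq (norm_nonneg _), dist_eq_norm,
      ← map_sub]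
  obtain ⟨e, he⟩ := cauchySeq_tendsto_of_complete hcau
  refine ⟨e, ?_, he⟩
  exact (isClosed_energyOp_adjoint_adjoint hd).mem_of_tendsto (h.1.prodMk_nhds he)
    (Eventually.of_forall fun n => mem_graph_energyOp_adjoint_adjoint hd (u n))

theorem exists_energyConverges (hd : Dense (T.domain : Set H)) {g : H} {e : EnergySpace T hT}
    (h : (g, e) ∈ (energyOp T hT).adjoint.adjoint.graph) :
    ∃ u : ℕ → T.domain, EnergyConverges T u g := by
  rw [graph_energyOp_adjoint_adjoint hd, ← SetLike.mem_coe, Submodule.topologicalClosure_coe,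
    mem_closure_iff_seq_limit] at h
  obtain ⟨p, hp, hlim⟩ := h
  choose u hu hu' using fun n => (mem_graph_energyOp _ _).1 (hp n)
  have h₁ : Tendsto (fun n => (p n).1) atTop (𝓝 g) := (continuous_fst.tendsto _).comp hlim
  have h₂ : Tendsto (fun n => (p n).2) atTop (𝓝 e) := (continuous_snd.tendsto _).comp hlim
  simp only [← hu] at h₁
  simp only [← hu'] at h₂
  refine ⟨u, h₁, ?_⟩
  have h₃ := (cauchySeq_iff_tendsto_dist_atTop_0.1 h₂.cauchySeq).pow 2
  have h₄ := (RCLike.continuous_ofReal (K := 𝕜)).tendsto _ |>.comp h₃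
  simp only [ne_eq, OfNat.ofNat_ne_zero, not_false_eq_true, zero_pow, RCLike.ofReal_zero] at h₄
  refine h₄.congr fun q => ?_
  simp only [Function.comp_apply]
  rw [inner_apply_self (hT := hT), dist_eq_norm, ← map_sub]

end Friedrichs

end FriedrichsExt


open FriedrichsExt in
theorem mainTheorem3 {𝕜 : Type*} [RCLike 𝕜]
    {H : Type*} [NormedAddCommGroup H] [InnerProductSpace 𝕜 H] [CompleteSpace H]
    (T : H →ₗ.[𝕜] H) (hT : FriedrichsExt.IsPositiveSymmetric T)
    (hdense : Dense (T.domain : Set H)) :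
    -- the adjoint of `Q_T` is densely defined, so that its second adjoint makes sense
    Dense ((FriedrichsExt.energyOp T hT).adjoint.domain :
      Set (FriedrichsExt.EnergySpace T hT)) ∧
    -- `T_F` is a positive self-adjoint extension of `T`
    FriedrichsExt.IsPositiveSymmetric (FriedrichsExt.friedrichs T hT) ∧
    IsSelfAdjoint (FriedrichsExt.friedrichs T hT) ∧
    T ≤ FriedrichsExt.friedrichs T hT ∧
    -- it is the largest one in the form order
    (∀ S : H →ₗ.[𝕜] H, FriedrichsExt.IsPositiveSymmetric S → IsSelfAdjoint S → T ≤ S →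
      FriedrichsExt.FormLE S (FriedrichsExt.friedrichs T hT)) ∧
    -- `T_F` has a positive self-adjoint square root `R = T_F^{1/2}`
    (∃ R : H →ₗ.[𝕜] H, FriedrichsExt.IsPositiveSqrt R (FriedrichsExt.friedrichs T hT)) ∧
    -- its domain consists of the limits of the energy-Cauchy sequences, and the norm is the limit
    -- of the energies along every such sequence
    ∀ R : H →ₗ.[𝕜] H, FriedrichsExt.IsPositiveSqrt R (FriedrichsExt.friedrichs T hT) →
      (∀ g : H, g ∈ R.domain ↔ ∃ u : ℕ → T.domain, FriedrichsExt.EnergyConverges T u g) ∧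
      (∀ (g : R.domain) (u : ℕ → T.domain), FriedrichsExt.EnergyConverges T u (g : H) →
        Tendsto (fun n => inner 𝕜 (T (u n)) (u n : H)) atTop (𝓝 ((‖R g‖ ^ 2 : ℝ) : 𝕜))) := by
  have hAd := dense_energyOp_adjoint_adjoint_domain (hT := hT) hdense
  have hAc := isClosed_energyOp_adjoint_adjoint (hT := hT) hdense
  refine ⟨dense_adjoint_energyOp_domain hdense, isPositiveSymmetric_friedrichs hdense,
    isSelfAdjoint_friedrichs hdense, le_friedrichs hdense,
    fun S hS hsa hTS => formLE_friedrichs hdense hS hsa hTS,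
    exists_isPositiveSqrt (isPositiveSymmetric_friedrichs hdense)
      (isSelfAdjoint_friedrichs hdense), fun R hR => ?_⟩
  have hRd := hR.selfAdjoint.dense_domain
  have hRc := hR.selfAdjoint.isClosed
  -- Applied in both directions, this equality identifies `dom R` with `dom Q_T**` and matches the
  -- norms, for an arbitrary square root `R`; uniqueness of the root is not needed.
  have hcomp : pcomp R.adjoint R =
      pcomp (energyOp T hT).adjoint.adjoint.adjoint (energyOp T hT).adjoint.adjoint := by
    rw [LinearPMap.isSelfAdjoint_def.1 hR.selfAdjoint, hR.comp_self, friedrichs_eq hdense]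
  refine ⟨fun g => ⟨fun hg => ?_, ?_⟩, fun g u hu => ?_⟩
  · obtain ⟨e, he, -⟩ := exists_mem_graph_norm_eq hRd hRc hAd hAc hcomp (R.mem_graph ⟨g, hg⟩)
    exact exists_energyConverges hdense he
  · rintro ⟨u, hu⟩
    obtain ⟨e, he, -⟩ := hu.exists_tendsto (hT := hT) hdense
    obtain ⟨z, hz, -⟩ := exists_mem_graph_norm_eq hAd hAc hRd hRc hcomp.symm he
    exact LinearPMap.mem_domain_of_mem_graph hz
  · obtain ⟨e, he, hlim⟩ := hu.exists_tendsto (hT := hT) hdense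
    obtain ⟨z, hz, hn⟩ := exists_mem_graph_norm_eq hAd hAc hRd hRc hcomp.symm he
    obtain rfl : R g = z := R.mem_graph_snd_inj (R.mem_graph g) hz rfl
    rw [hn]
    refine ((RCLike.continuous_ofReal (K := 𝕜)).tendsto _ |>.comp (hlim.norm.pow 2)).congr
      fun n => (inner_apply_self (u n)).symm
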